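/- For a finite set $S$ of points in the Euclidean plane let $\mathcal P(S)$ be the set of all simple polygons (closed regions bounded by a simple closed polygonal curve, every vertex being a genuine corner) whose vertex set equals $S$. For $P\in\mathcal P(S)$, a point $p\in P$ sees a point $q\in P$ if the segment $pq$ is contained in $P$. A set $G\subseteq S$ is a guard set for $P$ if every point of $P$ is seen by some point of $G$, and $G$ is a guard set for a set $A\subseteq\mathcal P(S)$ if it is a guard set for every $P\in A$; let $\mathrm{ug}(A)$ be the minimum cardinality of a guard set for $A$. For natural numbers $n,k$ let $$\mathrm{UG}_k(n)=\max_{\substack{S\subset\mathbb R^2\\ |S|=n}}\ \max_{\substack{A\subseteq\mathcal P(S)\\ |A|=k}}\ \mathrm{ug}(A)$$ be the $k$-universal guard number for simple polygons. **Theorem.** For every integer $n\ge 4$, $$\mathrm{UG}_2(n)\ \ge\ \left\lfloor \frac{3n}{8}\right\rfloor .$$ -/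

import Mathlib

/-- The Euclidean plane. -/
abbrev Plane : Type := EuclideanSpace ℝ (Fin 2)

/-- A (closed) polygon `p` with vertices `p 0, …, p (n - 1)` in the plane is *simple* if its
vertices are pairwise distinct, consecutive vertices are not collinear (every vertex is a genuine
corner), consecutive edges meet only in their common vertex, and all other pairs of distinct edges
are disjoint. The cyclic successor of the index `i` is `finRotate n i = i + 1`. -/
structure Polygon.IsSimple {n : ℕ} [NeZero n] (p : Polygon Plane n) : Prop where
  injective : Function.Injective p.vertices
  nondegenerate : p.HasNondegenerateVertices ℝ
  inter_adjacent : ∀ i : Fin n,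
    p.edgeSet ℝ i ∩ p.edgeSet ℝ (finRotate n i) = {p (finRotate n i)}
  disjoint_of_not_adjacent : ∀ i j : Fin n, i ≠ j → j ≠ finRotate n i → i ≠ finRotate n j →
    Disjoint (p.edgeSet ℝ i) (p.edgeSet ℝ j)

/-- The closed region bounded by a polygon: its boundary curve together with the bounded connected
components of the complement of that curve. -/
def Polygon.region {n : ℕ} (p : Polygon Plane n) : Set Plane :=
  p.boundary ℝ ∪
    {x | x ∉ p.boundary ℝ ∧ Bornology.IsBounded (connectedComponentIn (p.boundary ℝ)ᶜ x)}

/-- The set of all simple polygons, as closed regions of the plane, whose vertex set is `S`. -/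
def simplePolygons (S : Finset Plane) : Set (Set Plane) :=
  {P | ∃ (n : ℕ) (_ : NeZero n) (p : Polygon Plane n),
    p.IsSimple ∧ Set.range p.vertices = (S : Set Plane) ∧ P = p.region}

/-- The point `a` sees the point `b` with respect to `P` if the segment `ab` lies in `P`. -/
def Sees (P : Set Plane) (a b : Plane) : Prop := segment ℝ a b ⊆ P

/-- The visible region of `g` with respect to `P`. -/
def visibleRegion (P : Set Plane) (g : Plane) : Set Plane := {a | a ∈ P ∧ Sees P g a}

/-- `G` is a guard set for `P`: the visible regions of the points of `G` cover `P`. -/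
def IsGuardSet (G : Finset Plane) (P : Set Plane) : Prop :=
  (⋃ g ∈ G, visibleRegion P g) = P

/-- The minimum cardinality of a set `G ⊆ S` that is a guard set for every polygon in `A`. -/
noncomputable def guardNumber (S : Finset Plane) (A : Set (Set Plane)) : ℕ∞ :=
  ⨅ (G : Finset Plane) (_ : G ⊆ S ∧ ∀ P ∈ A, IsGuardSet G P), (G.card : ℕ∞)

/-- The `k`-universal guard number for simple polygons: the maximum, over all sets `S` of `n` points
in the plane and all sets `A` of exactly `k` simple polygons with vertex set `S`, of the minimum
cardinality of a common guard set for `A`. -/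
noncomputable def kUniversalGuardNumber (n k : ℕ) : ℕ∞ :=
  ⨆ (S : Finset Plane) (_ : S.card = n)
    (A : Set (Set Plane)) (_ : A ⊆ simplePolygons S ∧ A.encard = k), guardNumber S A

/-! The points are grouped into rooms of five, placed 30 apart, and the same points are joined in
two ways: in the order of `x + y` and in the order of `x - y`, each time closed by an edge along `y
= -1`. Full rooms read `L, A, B, T, R` in the first order and `L, T, A, B, R` in the second.

A chain on which `x + c y` increases is a graph over that functional. A point beyond a vertex in the
direction `(-c, 1)` can therefore escape to infinity and lies outside the polygon. So a segment
passing over a vertex is not a line of sight (`IsMonotoneChain.not_sees`), and every visibility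
claim becomes a numerical inequality.

The bases `L` and `R` hide `A` and `T` from all other rooms (`IsRoomChain.not_sees_of_room_ne`).
Inside a full room, the first polygon hides `T` from `L` and `A`, and the second hides `T` from `B`
and `R`. A single guard would thus have to be `T`, which misses `A` in the first polygon. Hence a
full room needs two guards (`two_le_card_guards`), and a final partial room with at least three
points needs one. With `n = 5q + r`, `r < 5`, this gives `2q`, plus one if `r ≥ 3`, which is at
least `⌊3n/8⌋`. -/

/-! ### Chains monotone for a linear functional -/

/-- The linear functional `x + c y` on the plane. -/
def skew (c : ℝ) (a : Plane) : ℝ := a 0 + c * a 1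

/-- The points `p 0, …, p N` form a chain along which `x + c y` increases strictly, without three
consecutive collinear points, whose endpoints lie on the line `y = -1` and whose other points lie
strictly above it. -/
structure IsMonotoneChain (c : ℝ) (p : ℕ → Plane) (N : ℕ) : Prop where
  two_le : 2 ≤ N
  lt_succ : ∀ i < N, skew c (p i) < skew c (p (i + 1))
  first : p 0 1 = -1
  last : p N 1 = -1
  above : ∀ i, 0 < i → i < N → -1 < p i 1
  corner : ∀ i, i + 2 ≤ N →
    (p (i + 1) 0 - p i 0) * (p (i + 2) 1 - p i 1) ≠ (p (i + 2) 0 - p i 0) * (p (i + 1) 1 - p i 1)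

/-- The polygon with vertices `p 0, …, p N`. -/
def chainPolygon (p : ℕ → Plane) (N : ℕ) : Polygon Plane (N + 1) := ⟨fun i => p i⟩

lemma exists_of_mem_affineSegment {x a b : Plane} (h : x ∈ affineSegment ℝ a b) :
    ∃ t : ℝ, 0 ≤ t ∧ t ≤ 1 ∧ x 0 = a 0 + t * (b 0 - a 0) ∧ x 1 = a 1 + t * (b 1 - a 1) := by
  obtain ⟨t, ht, rfl⟩ := h
  refine ⟨t, ht.1, ht.2, ?_, ?_⟩ <;> simp [AffineMap.lineMap_apply] <;> ring

lemma skew_eq_of_mem_affineSegment {c : ℝ} {x a b : Plane} (h : x ∈ affineSegment ℝ a b) :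
    ∃ t : ℝ, 0 ≤ t ∧ t ≤ 1 ∧ x 0 = a 0 + t * (b 0 - a 0) ∧ x 1 = a 1 + t * (b 1 - a 1) ∧
      skew c x = skew c a + t * (skew c b - skew c a) := by
  obtain ⟨t, h0, h1, hx, hy⟩ := exists_of_mem_affineSegment h
  refine ⟨t, h0, h1, hx, hy, ?_⟩
  simp only [skew, hx, hy]; ring

lemma Plane.ext {a b : Plane} (h0 : a 0 = b 0) (h1 : a 1 = b 1) : a = b := by
  ext i; fin_cases i <;> assumption

lemma skew_bounds_of_mem {c : ℝ} {x a b : Plane} (hab : skew c a < skew c b)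
    (h : x ∈ affineSegment ℝ a b) :
    skew c a ≤ skew c x ∧ skew c x ≤ skew c b ∧ (skew c x = skew c a → x = a) ∧
      (skew c x = skew c b → x = b) := by
  obtain ⟨t, h0, h1, hx, hy, hs⟩ := skew_eq_of_mem_affineSegment (c := c) h
  refine ⟨by nlinarith, by nlinarith, fun he => ?_, fun he => ?_⟩
  · have : t = 0 := by
      rcases mul_eq_zero.1 (show t * (skew c b - skew c a) = 0 by linarith) with h | h
      · exact h
      · linarith
    subst this
    exact Plane.ext (by simpa using hx) (by simpa using hy)
  · have : t = 1 := by
      rcases mul_eq_zero.1 (show (1 - t) * (skew c b - skew c a) = 0 by linarith) with h | h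
      · linarith
      · linarith
    subst this
    exact Plane.ext (by simpa using hx) (by simpa using hy)

lemma affineIndependent_of_cross_ne {a b d : Plane}
    (h : (b 0 - a 0) * (d 1 - a 1) ≠ (d 0 - a 0) * (b 1 - a 1)) :
    AffineIndependent ℝ ![a, b, d] := by
  rw [affineIndependent_iff_not_collinear_set, collinear_iff_of_mem (p₀ := a) (by simp)]
  rintro ⟨v, hv⟩
  obtain ⟨r, hr⟩ := hv b (by simp)
  obtain ⟨s, hs⟩ := hv d (by simp)
  apply h
  subst hr hs
  simp
  ring

lemma finRotate_val_of_lt {N : ℕ} {i : Fin (N + 1)} (h : i.val < N) :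
    (finRotate (N + 1) i).val = i.val + 1 := by
  rw [coe_finRotate_of_ne_last]
  intro e; rw [e] at h; simp at h

lemma finRotate_val_of_eq {N : ℕ} {i : Fin (N + 1)} (h : i.val = N) :
    (finRotate (N + 1) i).val = 0 := by
  have : i = Fin.last N := Fin.ext h
  subst this; simp

/-! ### Simplicity of the polygon closing a monotone chain -/

namespace IsMonotoneChain

variable {c : ℝ} {p : ℕ → Plane} {N : ℕ}

lemma skew_lt (h : IsMonotoneChain c p N) {i j : ℕ} (hij : i < j) (hj : j ≤ N) :
    skew c (p i) < skew c (p j) := by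
  induction j, hij using Nat.le_induction with
  | base => exact h.lt_succ i hj
  | succ j hij ih => exact (ih (by omega)).trans (h.lt_succ j hj)

lemma neg_one_le (h : IsMonotoneChain c p N) {i : ℕ} (hi : i ≤ N) : -1 ≤ p i 1 := by
  rcases Nat.eq_zero_or_pos i with rfl | h0
  · exact h.first.ge
  rcases hi.eq_or_lt with rfl | hN
  · exact h.last.ge
  · exact (h.above i h0 hN).le

lemma edgeSet_of_lt {i : Fin (N + 1)} (hi : i.val < N) :
    (chainPolygon p N).edgeSet ℝ i = affineSegment ℝ (p i) (p (i + 1)) := by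
  simp only [Polygon.edgeSet, chainPolygon, finRotate_val_of_lt hi]

lemma edgeSet_of_eq {i : Fin (N + 1)} (hi : i.val = N) :
    (chainPolygon p N).edgeSet ℝ i = affineSegment ℝ (p N) (p 0) := by
  simp only [Polygon.edgeSet, chainPolygon, finRotate_val_of_eq hi, hi]

/-- The closing edge lies on `y = -1`, and the chain reaches that height only at its two ends. -/
lemma eq_end_of_mem_inter (h : IsMonotoneChain c p N) {i : ℕ} (hi : i < N) {x : Plane}
    (h1 : x ∈ affineSegment ℝ (p i) (p (i + 1))) (h2 : x ∈ affineSegment ℝ (p N) (p 0)) :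
    i = 0 ∧ x = p 0 ∨ i + 1 = N ∧ x = p N := by
  obtain ⟨s, -, -, -, hy⟩ := exists_of_mem_affineSegment h2
  rw [h.first, h.last] at hy
  obtain ⟨t, t0, t1, hx', hy', hs⟩ := skew_eq_of_mem_affineSegment (c := c) h1
  have hN := h.two_le
  have hi1 := h.neg_one_le hi.le
  have hi2 := h.neg_one_le (i := i + 1) hi
  by_cases h0 : i = 0
  · left
    refine ⟨h0, ?_⟩
    subst h0
    have := h.above 1 one_pos (by omega)
    rw [h.first] at hy'
    have ht : t = 0 := by
      rcases mul_eq_zero.1 (show t * (p 1 1 + 1) = 0 by simp only [zero_add] at hy'; linarith)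
        with h | h
      · exact h
      · linarith
    subst ht
    exact Plane.ext (by simpa using hx') (by rw [hy', h.first]; ring)
  · right
    have := h.above i (by omega) hi
    have ht : t = 1 := by
      rcases eq_or_lt_of_le t1 with h | h
      · exact h
      · nlinarith
    subst ht
    have hxe : x = p (i + 1) := Plane.ext (by simpa using hx') (by simpa using hy')
    have hiN : i + 1 = N := by
      by_contra hne
      have := h.above (i + 1) (by omega) (by omega)
      rw [← hxe] at this
      linarith
    exact ⟨hiN, by rw [hxe, hiN]⟩

/-- The functional maps the edges to consecutive intervals, which overlap only at shared endpoints.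
-/
lemma eq_of_mem_inter (h : IsMonotoneChain c p N) {i j : ℕ} (hij : i < j) (hj : j < N) {x : Plane}
    (h1 : x ∈ affineSegment ℝ (p i) (p (i + 1))) (h2 : x ∈ affineSegment ℝ (p j) (p (j + 1))) :
    j = i + 1 ∧ x = p j := by
  obtain ⟨-, h1', -, -⟩ := skew_bounds_of_mem (h.lt_succ i (by omega)) h1
  obtain ⟨h2', -, h3, -⟩ := skew_bounds_of_mem (h.lt_succ j hj) h2
  have hji : j = i + 1 := by
    by_contra hne
    have := h.skew_lt (i := i + 1) (j := j) (by omega) hj.le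
    linarith
  subst hji
  exact ⟨rfl, h3 (le_antisymm h1' h2')⟩

theorem injective (h : IsMonotoneChain c p N) :
    Function.Injective (chainPolygon p N).vertices := by
  intro i j hij
  change p i = p j at hij
  rcases lt_trichotomy i.val j.val with hl | hl | hl
  · exact absurd (congrArg (skew c) hij) (h.skew_lt hl (by omega)).ne
  · exact Fin.ext hl
  · exact absurd (congrArg (skew c) hij) (h.skew_lt hl (by omega)).ne'

theorem hasNondegenerateVertices (h : IsMonotoneChain c p N) :
    (chainPolygon p N).HasNondegenerateVertices ℝ := by
  intro i
  have hN := h.two_le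
  have e2 : i + 2 = finRotate (N + 1) (finRotate (N + 1) i) := by
    obtain ⟨M, rfl⟩ := Nat.exists_eq_add_of_le' hN
    simp only [finRotate_apply, add_assoc]
    rfl
  rw [e2, ← finRotate_apply]
  apply affineIndependent_of_cross_ne
  change (p (finRotate (N + 1) i) 0 - p i 0) *
    (p (finRotate (N + 1) (finRotate (N + 1) i)) 1 - p i 1) ≠
    (p (finRotate (N + 1) (finRotate (N + 1) i)) 0 - p i 0) * (p (finRotate (N + 1) i) 1 - p i 1)
  have h0N := h.skew_lt (i := 0) (j := N) (by omega) le_rfl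
  have hx : p 0 0 < p N 0 := by
    simp only [skew, h.first, h.last] at h0N; linarith
  have hf := h.first
  have hl := h.last
  by_cases hi : i.val < N
  · have e1 := finRotate_val_of_lt hi
    by_cases hi' : i.val + 1 < N
    · have e3 := finRotate_val_of_lt (i := finRotate (N + 1) i) (by omega)
      rw [e3, e1]
      exact h.corner i (by omega)
    · have e3 := finRotate_val_of_eq (i := finRotate (N + 1) i) (by omega)
      have e4 : i.val + 1 = N := by omega
      have := h.above i (by omega) (by omega)
      rw [e3, e1, e4, hf, hl]
      intro he
      nlinarith
  · have e0 : i.val = N := by omega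
    have e1 := finRotate_val_of_eq e0
    have e3 := finRotate_val_of_lt (i := finRotate (N + 1) i) (by omega)
    have := h.above 1 (by omega) (by omega)
    rw [e3, e1, e0, hf, hl, zero_add]
    intro he
    nlinarith

theorem isSimple (h : IsMonotoneChain c p N) : (chainPolygon p N).IsSimple where
  injective := h.injective
  nondegenerate := h.hasNondegenerateVertices
  inter_adjacent i := by
    have hN := h.two_le
    apply Set.Subset.antisymm
    · rintro x ⟨h1, h2⟩
      change x = p (finRotate (N + 1) i)
      by_cases hi : i.val < N
      · have e1 := finRotate_val_of_lt hi
        rw [edgeSet_of_lt hi] at h1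
        rw [e1]
        by_cases hi' : i.val + 1 < N
        · rw [edgeSet_of_lt (by omega), e1] at h2
          exact (h.eq_of_mem_inter (Nat.lt_succ_self _) hi' h1 h2).2
        · rw [edgeSet_of_eq (by omega)] at h2
          rcases h.eq_end_of_mem_inter hi h1 h2 with ⟨a, -⟩ | ⟨a, b⟩
          · omega
          · rw [a, b]
      · have e0 : i.val = N := by omega
        have e1 := finRotate_val_of_eq e0
        rw [edgeSet_of_eq e0] at h1
        rw [edgeSet_of_lt (by omega), e1] at h2
        rw [e1]
        rcases h.eq_end_of_mem_inter (by omega) h2 h1 with ⟨-, b⟩ | ⟨a, -⟩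
        · exact b
        · omega
    · rintro x rfl
      exact ⟨right_mem_affineSegment ℝ _ _, left_mem_affineSegment ℝ _ _⟩
  disjoint_of_not_adjacent := by
    have key : ∀ i j : Fin (N + 1), i.val < j.val → j ≠ finRotate (N + 1) i →
        i ≠ finRotate (N + 1) j →
        Disjoint ((chainPolygon p N).edgeSet ℝ i) ((chainPolygon p N).edgeSet ℝ j) := by
      intro i j hij hj hi
      rw [Set.disjoint_left]
      intro x h1 h2
      have hiN : i.val < N := by omega
      rw [edgeSet_of_lt hiN] at h1
      by_cases hjN : j.val < N
      · rw [edgeSet_of_lt hjN] at h2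
        apply hj
        apply Fin.ext
        rw [finRotate_val_of_lt hiN]
        exact (h.eq_of_mem_inter hij hjN h1 h2).1
      · have ej : j.val = N := by omega
        rw [edgeSet_of_eq ej] at h2
        rcases h.eq_end_of_mem_inter hiN h1 h2 with ⟨a, -⟩ | ⟨a, -⟩
        · exact hi (Fin.ext (by rw [finRotate_val_of_eq ej, a]))
        · exact hj (Fin.ext (by rw [finRotate_val_of_lt hiN, a, ej]))
    intro i j hne hj hi
    rcases lt_or_gt_of_ne (fun e => hne (Fin.ext e) : i.val ≠ j.val) with hl | hl
    · exact key i j hl hj hi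
    · exact (key j i hl hi hj).symm

/-! ### Points above the chain, and blocked sight lines -/

lemma not_mem_boundary (h : IsMonotoneChain c p N) {b : ℕ} (hb : b ≤ N) {q : Plane}
    (hq : skew c q = skew c (p b)) (hy : p b 1 < q 1) : q ∉ (chainPolygon p N).boundary ℝ := by
  intro hmem
  obtain ⟨i, hi⟩ := Set.mem_iUnion.1 hmem
  have hne : q ≠ p b := fun e => by rw [e] at hy; exact hy.false
  by_cases hiN : i.val < N
  · rw [edgeSet_of_lt hiN] at hi
    obtain ⟨h1, h2, h3, h4⟩ := skew_bounds_of_mem (h.lt_succ i hiN) hi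
    rcases lt_trichotomy i.val b with hl | hl | hl
    · rcases (show i.val + 1 ≤ b from hl).eq_or_lt with e | e
      · exact hne (by rw [h4 (by rw [hq, e]), e])
      · have := h.skew_lt e hb
        linarith
    · exact hne (by rw [h3 (by rw [hq, hl]), hl])
    · have := h.skew_lt hl (by omega)
      linarith
  · rw [edgeSet_of_eq (by omega)] at hi
    obtain ⟨s, -, -, -, hs⟩ := exists_of_mem_affineSegment hi
    rw [h.first, h.last] at hs
    have := h.neg_one_le hb
    linarith

theorem not_mem_region (h : IsMonotoneChain c p N) {b : ℕ} (hb : b ≤ N) {q : Plane}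
    (hq : skew c q = skew c (p b)) (hy : p b 1 < q 1) : q ∉ (chainPolygon p N).region := by
  rintro (hm | ⟨-, hbd⟩)
  · exact h.not_mem_boundary hb hq hy hm
  -- The functional is constant along this direction while the height grows, so the ray never meets
  -- the boundary and the component of `q` is unbounded.
  let ray : ℝ → Plane := fun t => q + t • !₂[-c, 1]
  have ray0 (t : ℝ) : ray t 0 = q 0 - t * c := by simp [ray]; ring
  have ray1 (t : ℝ) : ray t 1 = q 1 + t := by simp [ray]
  have hcont : Continuous ray := by fun_prop
  have hsub : ray '' Set.Ici 0 ⊆ ((chainPolygon p N).boundary ℝ)ᶜ := by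
    rintro _ ⟨t, ht, rfl⟩
    refine h.not_mem_boundary hb ?_ ?_
    · rw [← hq]; simp only [skew, ray0, ray1]; ring
    · rw [ray1]; have : (0 : ℝ) ≤ t := ht; linarith
  have hcomp := (isPreconnected_Ici.image ray hcont.continuousOn).subset_connectedComponentIn
    (x := q) ⟨0, Set.self_mem_Ici, by simp [ray]⟩ hsub
  obtain ⟨C, hC⟩ := (hbd.subset hcomp).exists_norm_le
  have h1 := hC (ray (|q 1| + |C| + 1)) ⟨_, by simp only [Set.mem_Ici]; positivity, rfl⟩
  have h2 := (PiLp.norm_apply_le (ray (|q 1| + |C| + 1)) 1).trans h1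
  rw [ray1, Real.norm_eq_abs] at h2
  have h3 := le_abs_self (q 1 + (|q 1| + |C| + 1))
  have h4 := neg_abs_le (q 1)
  have h5 := le_abs_self C
  linarith

/-- The inequality `hy`, cleared of denominators, says that the segment is higher than `p b` where
it crosses the level of `p b`. -/
theorem not_sees (h : IsMonotoneChain c p N) {b : ℕ} (hb : b ≤ N) {g w : Plane}
    (hg : skew c g < skew c (p b)) (hw : skew c (p b) < skew c w)
    (hy : p b 1 * (skew c w - skew c g) <
      g 1 * (skew c w - skew c (p b)) + w 1 * (skew c (p b) - skew c g)) :
    ¬ Sees (chainPolygon p N).region g w := by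
  intro hs
  have hd : 0 < skew c w - skew c g := by linarith
  let t := (skew c (p b) - skew c g) / (skew c w - skew c g)
  have ht : t * (skew c w - skew c g) = skew c (p b) - skew c g := div_mul_cancel₀ _ hd.ne'
  have hq : AffineMap.lineMap g w t ∈ segment ℝ g w := by
    rw [segment_eq_image_lineMap]
    refine ⟨t, ⟨div_nonneg (by linarith) hd.le, (div_le_one hd).2 (by linarith)⟩, rfl⟩
  have q0 : (AffineMap.lineMap g w t : Plane) 0 = g 0 + t * (w 0 - g 0) := by
    simp [AffineMap.lineMap_apply]; ring
  have q1 : (AffineMap.lineMap g w t : Plane) 1 = g 1 + t * (w 1 - g 1) := by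
    simp [AffineMap.lineMap_apply]; ring
  refine h.not_mem_region hb ?_ ?_ (hs hq)
  · have : skew c (AffineMap.lineMap g w t : Plane) = skew c g + t * (skew c w - skew c g) := by
      simp only [skew, q0, q1]; ring
    rw [this, ht]; ring
  · rw [q1]
    have : (g 1 + t * (w 1 - g 1)) * (skew c w - skew c g) =
      g 1 * (skew c w - skew c (p b)) + w 1 * (skew c (p b) - skew c g) := by
      linear_combination (w 1 - g 1) * ht
    nlinarith

end IsMonotoneChain

lemma Sees.symm {P : Set Plane} {a b : Plane} (h : Sees P a b) : Sees P b a := by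
  rwa [Sees, segment_symm]

lemma mem_region_of_vertex (p : ℕ → Plane) {N i : ℕ} (hi : i ≤ N) :
    p i ∈ (chainPolygon p N).region := by
  refine Or.inl (Set.mem_iUnion.2 ⟨⟨i, by omega⟩, ?_⟩)
  exact left_mem_affineSegment ℝ _ _

lemma sees_succ (p : ℕ → Plane) {N i : ℕ} (hi : i < N) :
    Sees (chainPolygon p N).region (p i) (p (i + 1)) := by
  intro x hx
  refine Or.inl (Set.mem_iUnion.2 ⟨⟨i, by omega⟩, ?_⟩)
  rw [IsMonotoneChain.edgeSet_of_lt hi, affineSegment_eq_segment]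
  exact hx

lemma IsGuardSet.exists_sees {G : Finset Plane} {P : Set Plane} (h : IsGuardSet G P) {w : Plane}
    (hw : w ∈ P) : ∃ g ∈ G, Sees P g w := by
  rw [← h] at hw
  simp only [Set.mem_iUnion] at hw
  obtain ⟨g, hg, hs⟩ := hw
  exact ⟨g, hg, h ▸ hs.2⟩

/-! ### The rooms and the two chains through them -/

/-- The corners of a room: left base, left knee, right knee, tip, right base. -/
inductive RoomCorner
  | L | A | B | T | R

open RoomCorner

/-- The corner `c` of the room `k`, where the rooms are numbered `0, …, K`. -/
noncomputable def roomPoint (K k : ℕ) : RoomCorner → Plane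
  | L => !₂[30 * (k : ℝ) - 5, if k = 0 then -1 else 0]
  | A => !₂[30 * (k : ℝ) - 1, 1]
  | B => !₂[30 * (k : ℝ) + 1, 1]
  | T => !₂[30 * (k : ℝ), 3]
  | R => !₂[30 * (k : ℝ) + 5, if k = K then -1 else 0]

/-- The number of points of the room `k` when `N + 1` points are distributed over rooms. -/
def roomSize (N k : ℕ) : ℕ := min 5 (N + 1 - 5 * k)

/-- The corners of a room of the given size, ordered by `x + y`. -/
def rightCorner (len j : ℕ) : RoomCorner :=
  if j + 1 = len then R else if j = 0 then L else if j + 2 = len then T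
  else if j + 3 = len then B else A

/-- The corners of a room of the given size, ordered by `x - y`. -/
def leftCorner (len j : ℕ) : RoomCorner :=
  if j + 1 = len then R else if j = 0 then L else if j = 1 then T
  else if j + 2 = len then B else A

/-- The chain through all rooms whose teeth lean to the right. -/
noncomputable def rightChain (N i : ℕ) : Plane :=
  roomPoint (N / 5) (i / 5) (rightCorner (roomSize N (i / 5)) (i % 5))

/-- The chain through all rooms whose teeth lean to the left. -/
noncomputable def leftChain (N i : ℕ) : Plane :=
  roomPoint (N / 5) (i / 5) (leftCorner (roomSize N (i / 5)) (i % 5))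

/-- Consecutive points of the right-leaning chain. -/
inductive RightStep (K : ℕ) : ℕ → RoomCorner → ℕ → RoomCorner → Prop
  | LA k : RightStep K k L k A
  | LB k : RightStep K k L k B
  | LT k : RightStep K k L k T
  | LR : RightStep K K L K R
  | AB k : RightStep K k A k B
  | BT k : RightStep K k B k T
  | TR k : RightStep K k T k R
  | RL k : k < K → RightStep K k R (k + 1) L
  | RR k : k + 1 = K → RightStep K k R (k + 1) R

/-- Consecutive points of the left-leaning chain. -/
inductive LeftStep (K : ℕ) : ℕ → RoomCorner → ℕ → RoomCorner → Prop
  | LT k : LeftStep K k L k T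
  | LR : LeftStep K K L K R
  | TA k : LeftStep K k T k A
  | TB k : LeftStep K k T k B
  | TR k : LeftStep K k T k R
  | AB k : LeftStep K k A k B
  | BR k : LeftStep K k B k R
  | RL k : k < K → LeftStep K k R (k + 1) L
  | RR k : k + 1 = K → LeftStep K k R (k + 1) R

lemma index_cases {N i : ℕ} (hi : i ≤ N) : ∃ k len j, i = 5 * k + j ∧ i / 5 = k ∧ i % 5 = j ∧
    roomSize N k = len ∧ j < len ∧ len ≤ 5 ∧ 5 * k + len ≤ N + 1 ∧
    (len = 5 ∨ 5 * k + len = N + 1) := by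
  refine ⟨i / 5, roomSize N (i / 5), i % 5, by omega, rfl, rfl, rfl, ?_, ?_, ?_, ?_⟩ <;>
    simp only [roomSize] <;> omega

lemma rightStep {N i : ℕ} (hi : i < N) :
    RightStep (N / 5) (i / 5) (rightCorner (roomSize N (i / 5)) (i % 5))
      ((i + 1) / 5) (rightCorner (roomSize N ((i + 1) / 5)) ((i + 1) % 5)) := by
  obtain ⟨k, len, j, e, e1, e2, e3, hj, h5, hN, hor⟩ := index_cases hi.le
  by_cases hlt : j + 1 < len
  · rw [show (i + 1) / 5 = k by omega, show (i + 1) % 5 = j + 1 by omega, e1, e2, e3]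
    -- Only the last room can be incomplete. There `R` has height `-1`, which keeps a direct step
    -- from `L` to `R` off the line `y = 0`.
    have h2 : len = 2 → k = N / 5 := by omega
    clear e3
    interval_cases len <;> interval_cases j <;> (try omega) <;> simp [rightCorner] <;> first
      | exact RightStep.LA _
      | exact RightStep.LB _
      | exact RightStep.LT _
      | exact RightStep.AB _
      | exact RightStep.BT _
      | exact RightStep.TR _
      | (rw [h2 rfl]; exact RightStep.LR)
  · have hj5 : j = 4 := by omega
    have hlen : len = 5 := by omega
    rw [show (i + 1) / 5 = k + 1 by omega, show (i + 1) % 5 = 0 by omega, e1, e2, e3, hlen, hj5]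
    by_cases h1 : roomSize N (k + 1) = 1
    · rw [h1]
      simp only [roomSize] at h1
      exact RightStep.RR k (by omega)
    · have : rightCorner (roomSize N (k + 1)) 0 = L := by
        simp [rightCorner, Ne.symm h1]
      rw [this]
      exact RightStep.RL k (by omega)

lemma leftStep {N i : ℕ} (hi : i < N) :
    LeftStep (N / 5) (i / 5) (leftCorner (roomSize N (i / 5)) (i % 5))
      ((i + 1) / 5) (leftCorner (roomSize N ((i + 1) / 5)) ((i + 1) % 5)) := by
  obtain ⟨k, len, j, e, e1, e2, e3, hj, h5, hN, hor⟩ := index_cases hi.le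
  by_cases hlt : j + 1 < len
  · rw [show (i + 1) / 5 = k by omega, show (i + 1) % 5 = j + 1 by omega, e1, e2, e3]
    have h2 : len = 2 → k = N / 5 := by omega
    clear e3
    interval_cases len <;> interval_cases j <;> (try omega) <;> simp [leftCorner] <;> first
      | exact LeftStep.LT _
      | exact LeftStep.TA _
      | exact LeftStep.TB _
      | exact LeftStep.TR _
      | exact LeftStep.AB _
      | exact LeftStep.BR _
      | (rw [h2 rfl]; exact LeftStep.LR)
  · have hj5 : j = 4 := by omega
    have hlen : len = 5 := by omega
    rw [show (i + 1) / 5 = k + 1 by omega, show (i + 1) % 5 = 0 by omega, e1, e2, e3, hlen, hj5]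
    by_cases h1 : roomSize N (k + 1) = 1
    · rw [h1]
      simp only [roomSize] at h1
      exact LeftStep.RR k (by omega)
    · have : leftCorner (roomSize N (k + 1)) 0 = L := by
        simp [leftCorner, Ne.symm h1]
      rw [this]
      exact LeftStep.RL k (by omega)

section coordinates

variable (K k : ℕ)

@[simp] lemma roomPoint_L_zero : roomPoint K k L 0 = 30 * (k : ℝ) - 5 := rfl
@[simp] lemma roomPoint_A_zero : roomPoint K k A 0 = 30 * (k : ℝ) - 1 := rfl
@[simp] lemma roomPoint_B_zero : roomPoint K k B 0 = 30 * (k : ℝ) + 1 := rfl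
@[simp] lemma roomPoint_T_zero : roomPoint K k T 0 = 30 * (k : ℝ) := rfl
@[simp] lemma roomPoint_R_zero : roomPoint K k R 0 = 30 * (k : ℝ) + 5 := rfl
@[simp] lemma roomPoint_A_one : roomPoint K k A 1 = 1 := rfl
@[simp] lemma roomPoint_B_one : roomPoint K k B 1 = 1 := rfl
@[simp] lemma roomPoint_T_one : roomPoint K k T 1 = 3 := rfl
lemma roomPoint_L_one : roomPoint K k L 1 = if k = 0 then -1 else 0 := rfl
lemma roomPoint_R_one : roomPoint K k R 1 = if k = K then -1 else 0 := rfl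

lemma roomPoint_L_one_mem : -1 ≤ roomPoint K k L 1 ∧ roomPoint K k L 1 ≤ 0 := by
  rw [roomPoint_L_one]; split_ifs <;> norm_num

lemma roomPoint_R_one_mem : -1 ≤ roomPoint K k R 1 ∧ roomPoint K k R 1 ≤ 0 := by
  rw [roomPoint_R_one]; split_ifs <;> norm_num

@[simp] lemma roomPoint_L_succ_one : roomPoint K (k + 1) L 1 = 0 := by simp [roomPoint_L_one]

@[simp] lemma roomPoint_R_self_one : roomPoint K K R 1 = -1 := by simp [roomPoint_R_one]

variable {K k}

lemma roomPoint_R_one_of_lt (h : k < K) : roomPoint K k R 1 = 0 := by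
  simp [roomPoint_R_one, h.ne]

end coordinates

lemma RightStep.skew_lt {K k k' : ℕ} {c c' : RoomCorner} (h : RightStep K k c k' c') :
    skew 1 (roomPoint K k c) < skew 1 (roomPoint K k' c') := by
  have hL := roomPoint_L_one_mem K k
  have hR := roomPoint_R_one_mem K k
  cases h
  case RR h => subst h; simp only [skew, roomPoint_R_zero, roomPoint_R_self_one]; push_cast; linarith
  case RL h =>
    simp only [skew, roomPoint_R_zero, roomPoint_L_zero, roomPoint_L_succ_one]; push_cast; linarith
  all_goals
    simp only [skew, roomPoint_L_zero, roomPoint_A_zero, roomPoint_B_zero, roomPoint_T_zero,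
      roomPoint_R_zero, roomPoint_A_one, roomPoint_B_one, roomPoint_T_one]
    linarith

lemma LeftStep.skew_lt {K k k' : ℕ} {c c' : RoomCorner} (h : LeftStep K k c k' c') :
    skew (-1) (roomPoint K k c) < skew (-1) (roomPoint K k' c') := by
  have hL := roomPoint_L_one_mem K k
  have hR := roomPoint_R_one_mem K k
  cases h
  case RR h => subst h; simp only [skew, roomPoint_R_zero, roomPoint_R_self_one]; push_cast; linarith
  case RL h =>
    simp only [skew, roomPoint_R_zero, roomPoint_L_zero, roomPoint_L_succ_one]; push_cast; linarith
  all_goals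
    simp only [skew, roomPoint_L_zero, roomPoint_A_zero, roomPoint_B_zero, roomPoint_T_zero,
      roomPoint_R_zero, roomPoint_A_one, roomPoint_B_one, roomPoint_T_one]
    linarith

/-- The three points are not collinear. -/
abbrev CrossNe (a b d : Plane) : Prop :=
  (b 0 - a 0) * (d 1 - a 1) ≠ (d 0 - a 0) * (b 1 - a 1)

/-- Room offsets cancel in horizontal differences, so in each case the determinant is affine in the
heights of the bases, which lie in `[-1, 0]`. -/
lemma RightStep.crossNe {K k₁ k₂ k₃ : ℕ} {c₁ c₂ c₃ : RoomCorner}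
    (h : RightStep K k₁ c₁ k₂ c₂) (h' : RightStep K k₂ c₂ k₃ c₃) :
    CrossNe (roomPoint K k₁ c₁) (roomPoint K k₂ c₂) (roomPoint K k₃ c₃) := by
  have hL := roomPoint_L_one_mem K k₁
  have hR := roomPoint_R_one_mem K k₃
  cases h <;> cases h' <;> (try omega) <;> (intro he) <;>
    (try rw [roomPoint_R_one_of_lt ‹_›] at he) <;> (try subst K) <;>
    simp only [roomPoint_L_zero, roomPoint_A_zero, roomPoint_B_zero, roomPoint_T_zero,
      roomPoint_R_zero, roomPoint_A_one, roomPoint_B_one, roomPoint_T_one, roomPoint_L_succ_one,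
      roomPoint_R_self_one, Nat.cast_add, Nat.cast_one] at he <;>
    (try rw [roomPoint_R_one_of_lt (Nat.lt_succ_self _)] at he) <;> linarith

lemma LeftStep.crossNe {K k₁ k₂ k₃ : ℕ} {c₁ c₂ c₃ : RoomCorner}
    (h : LeftStep K k₁ c₁ k₂ c₂) (h' : LeftStep K k₂ c₂ k₃ c₃) :
    CrossNe (roomPoint K k₁ c₁) (roomPoint K k₂ c₂) (roomPoint K k₃ c₃) := by
  have hL := roomPoint_L_one_mem K k₁
  have hR := roomPoint_R_one_mem K k₃
  cases h <;> cases h' <;> (try omega) <;> (intro he) <;>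
    (try rw [roomPoint_R_one_of_lt ‹_›] at he) <;> (try subst K) <;>
    simp only [roomPoint_L_zero, roomPoint_A_zero, roomPoint_B_zero, roomPoint_T_zero,
      roomPoint_R_zero, roomPoint_A_one, roomPoint_B_one, roomPoint_T_one, roomPoint_L_succ_one,
      roomPoint_R_self_one, Nat.cast_add, Nat.cast_one] at he <;>
    (try rw [roomPoint_R_one_of_lt (Nat.lt_succ_self _)] at he) <;> linarith

lemma rightCorner_eq_L {len j : ℕ} (h : rightCorner len j = L) : j = 0 := by
  unfold rightCorner at h; split_ifs at h; all_goals simp_all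

lemma rightCorner_eq_R {len j : ℕ} (h : rightCorner len j = R) : j + 1 = len := by
  unfold rightCorner at h; split_ifs at h; all_goals simp_all

lemma leftCorner_eq_L {len j : ℕ} (h : leftCorner len j = L) : j = 0 := by
  unfold leftCorner at h; split_ifs at h; all_goals simp_all

lemma leftCorner_eq_R {len j : ℕ} (h : leftCorner len j = R) : j + 1 = len := by
  unfold leftCorner at h; split_ifs at h; all_goals simp_all

lemma roomPoint_above {K k : ℕ} {c : RoomCorner} (hL : c = L → k ≠ 0) (hR : c = R → k ≠ K) :
    -1 < roomPoint K k c 1 := by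
  cases c
  · simp [roomPoint_L_one, hL rfl]
  · simp
  · simp
  · simp; norm_num
  · simp [roomPoint_R_one, hR rfl]

theorem isMonotoneChain_rightChain {N : ℕ} (hN : 3 ≤ N) :
    IsMonotoneChain 1 (rightChain N) N where
  two_le := by omega
  lt_succ i hi := (rightStep hi).skew_lt
  first := by
    have : rightCorner (roomSize N 0) 0 = L := by
      simp only [rightCorner, roomSize]; split_ifs <;> first | omega | rfl
    simp [rightChain, this, roomPoint_L_one]
  last := by
    have : rightCorner (roomSize N (N / 5)) (N % 5) = R := by
      rw [show roomSize N (N / 5) = N % 5 + 1 by simp only [roomSize]; omega]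
      simp [rightCorner]
    simp [rightChain, this]
  above i h0 hi := by
    refine roomPoint_above (fun h => ?_) (fun h => ?_)
    · have := rightCorner_eq_L h; omega
    · have := rightCorner_eq_R h; simp only [roomSize] at this; omega
  corner i hi := (rightStep (by omega)).crossNe (rightStep (by omega))

theorem isMonotoneChain_leftChain {N : ℕ} (hN : 3 ≤ N) :
    IsMonotoneChain (-1) (leftChain N) N where
  two_le := by omega
  lt_succ i hi := (leftStep hi).skew_lt
  first := by
    have : leftCorner (roomSize N 0) 0 = L := by
      simp only [leftCorner, roomSize]; split_ifs <;> first | omega | rfl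
    simp [leftChain, this, roomPoint_L_one]
  last := by
    have : leftCorner (roomSize N (N / 5)) (N % 5) = R := by
      rw [show roomSize N (N / 5) = N % 5 + 1 by simp only [roomSize]; omega]
      simp [leftCorner]
    simp [leftChain, this]
  above i h0 hi := by
    refine roomPoint_above (fun h => ?_) (fun h => ?_)
    · have := leftCorner_eq_L h; omega
    · have := leftCorner_eq_R h; simp only [roomSize] at this; omega
  corner i hi := (leftStep (by omega)).crossNe (leftStep (by omega))

lemma rightChain_eq {N k len j : ℕ} (hlen : roomSize N k = len) (hj : j < 5) :
    rightChain N (5 * k + j) = roomPoint (N / 5) k (rightCorner len j) := by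
  simp only [rightChain, show (5 * k + j) / 5 = k by omega, show (5 * k + j) % 5 = j by omega, hlen]

lemma leftChain_eq {N k len j : ℕ} (hlen : roomSize N k = len) (hj : j < 5) :
    leftChain N (5 * k + j) = roomPoint (N / 5) k (leftCorner len j) := by
  simp only [leftChain, show (5 * k + j) / 5 = k by omega, show (5 * k + j) % 5 = j by omega, hlen]

/-! ### The common vertex set -/

open Classical in
/-- The `N + 1` points of all rooms. -/
noncomputable def roomPoints (N : ℕ) : Finset Plane := (Finset.range (N + 1)).image (rightChain N)

lemma mem_roomPoints {N : ℕ} {x : Plane} : x ∈ roomPoints N ↔ ∃ i ≤ N, rightChain N i = x := by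
  simp [roomPoints]

lemma leftChain_mem_roomPoints {N i : ℕ} (hi : i ≤ N) : leftChain N i ∈ roomPoints N := by
  obtain ⟨k, len, j, e, e1, e2, e3, hj, h5, hN, hor⟩ := index_cases hi
  rw [e, leftChain_eq e3 (by omega), mem_roomPoints]
  have key : ∃ j' < len, rightCorner len j' = leftCorner len j := by
    clear e3
    -- The two orders of a room differ only in that `T` moves from the second place to the last but
    -- one, shifting the knees down by one.
    refine ⟨if j = 0 then 0 else if j + 1 = len then j else if j = 1 then len - 2 else j - 1,
      by split_ifs <;> omega, ?_⟩
    interval_cases len <;> interval_cases j <;> rfl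
  obtain ⟨j', hj', h⟩ := key
  exact ⟨5 * k + j', by omega, by rw [rightChain_eq e3 (by omega), h]⟩

lemma card_image_chain {c : ℝ} {p : ℕ → Plane} {N : ℕ} [DecidableEq Plane]
    (h : IsMonotoneChain c p N) : ((Finset.range (N + 1)).image p).card = N + 1 := by
  rw [Finset.card_image_of_injOn, Finset.card_range]
  intro i hi j hj hij
  simp only [Finset.coe_range, Set.mem_Iio] at hi hj
  have := h.injective (a₁ := ⟨i, hi⟩) (a₂ := ⟨j, hj⟩) hij
  simpa using this

lemma card_roomPoints {N : ℕ} (hN : 3 ≤ N) : (roomPoints N).card = N + 1 := by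
  classical
  unfold roomPoints
  convert card_image_chain (isMonotoneChain_rightChain hN)

/-- Both chains are injective with `N + 1` points, so one inclusion between their images suffices.
-/
lemma mem_roomPoints_iff_leftChain {N : ℕ} (hN : 3 ≤ N) {x : Plane} :
    x ∈ roomPoints N ↔ ∃ i ≤ N, leftChain N i = x := by
  classical
  have hsub : (Finset.range (N + 1)).image (leftChain N) ⊆ roomPoints N := by
    intro x hx
    obtain ⟨i, hi, rfl⟩ := Finset.mem_image.1 hx
    exact leftChain_mem_roomPoints (Nat.lt_succ_iff.1 (Finset.mem_range.1 hi))
  have := Finset.eq_of_subset_of_card_le hsub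
    (by rw [card_roomPoints hN, card_image_chain (isMonotoneChain_leftChain hN)])
  rw [← this]
  simp

lemma range_chainPolygon {p : ℕ → Plane} {N : ℕ} {S : Finset Plane}
    (h : ∀ x, x ∈ S ↔ ∃ i ≤ N, p i = x) : Set.range (chainPolygon p N).vertices = S := by
  ext x
  rw [Finset.mem_coe, h]
  constructor
  · rintro ⟨i, rfl⟩
    exact ⟨i, by omega, rfl⟩
  · rintro ⟨i, hi, rfl⟩
    exact ⟨⟨i, by omega⟩, rfl⟩

lemma roomPoint_mem {N k : ℕ} (j : ℕ) {len : ℕ} {c : RoomCorner}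
    (hlen : roomSize N k = len) (hj : j < len) (hc : rightCorner len j = c) :
    roomPoint (N / 5) k c ∈ roomPoints N := by
  have : roomSize N k ≤ 5 ∧ roomSize N k ≤ N + 1 - 5 * k := by
    simp only [roomSize]; omega
  rw [mem_roomPoints]
  exact ⟨5 * k + j, by omega, by rw [rightChain_eq hlen (by omega), hc]⟩

lemma L_mem {N k : ℕ} (h : 5 * k + 1 ≤ N) : roomPoint (N / 5) k L ∈ roomPoints N := by
  have : 2 ≤ roomSize N k := by simp only [roomSize]; omega
  refine roomPoint_mem 0 rfl (by omega) ?_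
  simp only [rightCorner]; split_ifs <;> first | omega | rfl

lemma T_mem {N k : ℕ} (h : 5 * k + 2 ≤ N) : roomPoint (N / 5) k T ∈ roomPoints N := by
  have : 3 ≤ roomSize N k := by simp only [roomSize]; omega
  refine roomPoint_mem (roomSize N k - 2) rfl (by omega) ?_
  simp only [rightCorner]; split_ifs <;> first | omega | rfl

lemma B_mem {N k : ℕ} (h : 5 * k + 3 ≤ N) : roomPoint (N / 5) k B ∈ roomPoints N := by
  have : 4 ≤ roomSize N k := by simp only [roomSize]; omega
  refine roomPoint_mem (roomSize N k - 3) rfl (by omega) ?_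
  simp only [rightCorner]; split_ifs <;> first | omega | rfl

lemma A_mem {N k : ℕ} (h : 5 * k + 4 ≤ N) : roomPoint (N / 5) k A ∈ roomPoints N := by
  have : roomSize N k = 5 := by simp only [roomSize]; omega
  exact roomPoint_mem 1 this (by omega) rfl

lemma R_mem {N k : ℕ} (h : 5 * k + 4 ≤ N) : roomPoint (N / 5) k R ∈ roomPoints N := by
  have : roomSize N k = 5 := by simp only [roomSize]; omega
  exact roomPoint_mem 4 this (by omega) rfl

lemma exists_room {N : ℕ} {x : Plane} (hx : x ∈ roomPoints N) :
    ∃ k c, k ≤ N / 5 ∧ x = roomPoint (N / 5) k c := by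
  obtain ⟨i, hi, rfl⟩ := mem_roomPoints.1 hx
  exact ⟨i / 5, _, Nat.div_le_div_right hi, rfl⟩

lemma roomPoint_bounds (K k : ℕ) (c : RoomCorner) :
    30 * (k : ℝ) - 5 ≤ roomPoint K k c 0 ∧ roomPoint K k c 0 ≤ 30 * k + 5 ∧
      -1 ≤ roomPoint K k c 1 ∧ |skew 1 (roomPoint K k c) - 30 * k| ≤ 6 ∧
      |skew (-1) (roomPoint K k c) - 30 * k| ≤ 6 := by
  have hL := roomPoint_L_one_mem K k
  have hR := roomPoint_R_one_mem K k
  simp only [abs_le, skew]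
  cases c <;> simp only [roomPoint_L_zero, roomPoint_A_zero, roomPoint_B_zero, roomPoint_T_zero,
    roomPoint_R_zero, roomPoint_A_one, roomPoint_B_one, roomPoint_T_one] <;>
    refine ⟨?_, ?_, ?_, ⟨?_, ?_⟩, ?_, ?_⟩ <;> linarith

/-! ### Visibility between rooms and inside a room -/

/-- A monotone chain through the points of all rooms. -/
structure IsRoomChain (c : ℝ) (p : ℕ → Plane) (N : ℕ) : Prop extends IsMonotoneChain c p N where
  mem_iff : ∀ x, x ∈ roomPoints N ↔ ∃ i ≤ N, p i = x
  slope : c = 1 ∨ c = -1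

lemma isRoomChain_rightChain {N : ℕ} (hN : 3 ≤ N) : IsRoomChain 1 (rightChain N) N where
  toIsMonotoneChain := isMonotoneChain_rightChain hN
  mem_iff _ := mem_roomPoints
  slope := Or.inl rfl

lemma isRoomChain_leftChain {N : ℕ} (hN : 3 ≤ N) : IsRoomChain (-1) (leftChain N) N where
  toIsMonotoneChain := isMonotoneChain_leftChain hN
  mem_iff _ := mem_roomPoints_iff_leftChain hN
  slope := Or.inr rfl

namespace IsRoomChain

variable {c : ℝ} {p : ℕ → Plane} {N : ℕ}

lemma not_sees_over (h : IsRoomChain c p N) {b g w : Plane} (hb : b ∈ roomPoints N)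
    (hg : skew c g < skew c b) (hw : skew c b < skew c w)
    (hy : b 1 * (skew c w - skew c g) <
      g 1 * (skew c w - skew c b) + w 1 * (skew c b - skew c g)) :
    ¬ Sees (chainPolygon p N).region g w := by
  obtain ⟨i, hi, rfl⟩ := (h.mem_iff b).1 hb
  exact h.not_sees hi hg hw hy

lemma mem_region (h : IsRoomChain c p N) {w : Plane} (hw : w ∈ roomPoints N) :
    w ∈ (chainPolygon p N).region := by
  obtain ⟨i, hi, rfl⟩ := (h.mem_iff w).1 hw
  exact mem_region_of_vertex p hi

lemma mem_simplePolygons (h : IsRoomChain c p N) :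
    (chainPolygon p N).region ∈ simplePolygons (roomPoints N) :=
  ⟨N + 1, inferInstance, chainPolygon p N, h.isSimple, range_chainPolygon h.mem_iff, rfl⟩

/-- A point of positive height in a room is not seen from other rooms. -/
lemma not_sees_of_room_ne (h : IsRoomChain c p N) {k k' : ℕ} {d d' : RoomCorner}
    (hk' : k' ≤ N / 5) (hk : 5 * k + 2 ≤ N) (hne : k' ≠ k) (hd : d = A ∨ d = T) :
    ¬ Sees (chainPolygon p N).region (roomPoint (N / 5) k' d') (roomPoint (N / 5) k d) := by
  obtain ⟨-, -, hy, hs1, hs2⟩ := roomPoint_bounds (N / 5) k' d'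
  have hs : |skew c (roomPoint (N / 5) k' d') - 30 * k'| ≤ 6 := by
    rcases h.slope with rfl | rfl <;> assumption
  have hw : |skew c (roomPoint (N / 5) k d) - 30 * k| ≤ 3 ∧ 1 ≤ roomPoint (N / 5) k d 1 := by
    rw [abs_le]
    rcases h.slope with rfl | rfl <;> rcases hd with rfl | rfl <;>
      simp only [skew, roomPoint_A_zero, roomPoint_A_one, roomPoint_T_zero, roomPoint_T_one] <;>
      refine ⟨⟨?_, ?_⟩, ?_⟩ <;> linarith
  obtain ⟨hw, hwy⟩ := hw
  rw [abs_le] at hs hw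
  rcases lt_or_gt_of_ne hne with hlt | hlt
  · have hk0 : (k' : ℝ) + 1 ≤ k := by exact_mod_cast hlt
    have hb1 : roomPoint (N / 5) k L 1 = 0 := by
      rw [roomPoint_L_one, if_neg (by omega)]
    have hbs : skew c (roomPoint (N / 5) k L) = 30 * k - 5 := by
      simp [skew, hb1]
    -- In the functional the guard is at least 19 before `L` and the target at most 8 after it.
    -- Heights at least `-1` and `1` then put the segment above height `0` over `L`.
    refine h.not_sees_over (L_mem (k := k) (by omega)) (by linarith) (by linarith) ?_
    rw [hb1, hbs]
    nlinarith
  · have hk0 : (k : ℝ) + 1 ≤ k' := by exact_mod_cast hlt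
    -- A later room exists, so room `k` is full and its `R` is not the lowered end of the chain.
    have hb1 : roomPoint (N / 5) k R 1 = 0 := roomPoint_R_one_of_lt (by omega)
    have hbs : skew c (roomPoint (N / 5) k R) = 30 * k + 5 := by
      simp [skew, hb1]
    refine fun hs => h.not_sees_over (R_mem (k := k) (by omega)) (by linarith) (by linarith) ?_
      hs.symm
    rw [hb1, hbs]
    nlinarith

end IsRoomChain

section visibility

variable {N k : ℕ}

lemma right_L_not_sees_T (hN : 3 ≤ N) (hk : 5 * k + 3 ≤ N) :
    ¬ Sees (chainPolygon (rightChain N) N).region (roomPoint (N / 5) k L)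
      (roomPoint (N / 5) k T) := by
  have hL := roomPoint_L_one_mem (N / 5) k
  refine (isRoomChain_rightChain hN).not_sees_over (B_mem hk) ?_ ?_ ?_ <;>
    simp only [skew, roomPoint_L_zero, roomPoint_B_zero, roomPoint_T_zero, roomPoint_B_one,
      roomPoint_T_one] <;> linarith

lemma right_A_not_sees_T (hN : 3 ≤ N) (hk : 5 * k + 3 ≤ N) :
    ¬ Sees (chainPolygon (rightChain N) N).region (roomPoint (N / 5) k A)
      (roomPoint (N / 5) k T) := by
  refine (isRoomChain_rightChain hN).not_sees_over (B_mem hk) ?_ ?_ ?_ <;>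
    simp only [skew, roomPoint_A_zero, roomPoint_B_zero, roomPoint_T_zero, roomPoint_A_one,
      roomPoint_B_one, roomPoint_T_one] <;> linarith

lemma left_T_not_sees_B (hN : 3 ≤ N) (hk : 5 * k + 4 ≤ N) :
    ¬ Sees (chainPolygon (leftChain N) N).region (roomPoint (N / 5) k T)
      (roomPoint (N / 5) k B) := by
  refine (isRoomChain_leftChain hN).not_sees_over (A_mem hk) ?_ ?_ ?_ <;>
    simp only [skew, roomPoint_A_zero, roomPoint_B_zero, roomPoint_T_zero, roomPoint_A_one,
      roomPoint_B_one, roomPoint_T_one] <;> linarith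

lemma left_T_not_sees_R (hN : 3 ≤ N) (hk : 5 * k + 3 ≤ N) :
    ¬ Sees (chainPolygon (leftChain N) N).region (roomPoint (N / 5) k T)
      (roomPoint (N / 5) k R) := by
  have hR := roomPoint_R_one_mem (N / 5) k
  refine (isRoomChain_leftChain hN).not_sees_over (B_mem hk) ?_ ?_ ?_ <;>
    simp only [skew, roomPoint_R_zero, roomPoint_B_zero, roomPoint_T_zero, roomPoint_B_one,
      roomPoint_T_one] <;> linarith

lemma right_T_sees_R (hN : 3 ≤ N) :
    Sees (chainPolygon (rightChain N) N).region (roomPoint (N / 5) 0 T)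
      (roomPoint (N / 5) 0 R) := by
  have hs : 4 ≤ roomSize N 0 ∧ roomSize N 0 ≤ 5 ∧ roomSize N 0 ≤ N + 1 := by
    simp only [roomSize]; omega
  have h := sees_succ (rightChain N) (N := N) (i := roomSize N 0 - 2) (by omega)
  have e1 := rightChain_eq (N := N) (k := 0) (j := roomSize N 0 - 2) rfl (by omega)
  have e2 := rightChain_eq (N := N) (k := 0) (j := roomSize N 0 - 2 + 1) rfl (by omega)
  have c1 : rightCorner (roomSize N 0) (roomSize N 0 - 2) = T := by
    simp only [rightCorner]; split_ifs <;> first | omega | rfl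
  have c2 : rightCorner (roomSize N 0) (roomSize N 0 - 2 + 1) = R := by
    simp only [rightCorner]; split_ifs <;> first | omega | rfl
  rw [mul_zero, zero_add, c1] at e1
  rw [mul_zero, zero_add, c2] at e2
  rwa [e1, e2] at h

/-- Needed for the family to have exactly two members: in room 0, `T` and `R` span an edge of one
polygon and are hidden from each other in the other. -/
theorem region_right_ne_left (hN : 3 ≤ N) :
    (chainPolygon (rightChain N) N).region ≠ (chainPolygon (leftChain N) N).region := fun h =>
  left_T_not_sees_R (k := 0) hN (by omega) (h ▸ right_T_sees_R hN)

end visibility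

/-! ### Counting guards room by room -/

/-- The index of the room of a point. -/
noncomputable def roomIndex (x : Plane) : ℕ := ⌊(x 0 + 15) / 30⌋₊

lemma roomIndex_roomPoint (K k : ℕ) (c : RoomCorner) : roomIndex (roomPoint K k c) = k := by
  obtain ⟨h1, h2, -⟩ := roomPoint_bounds K k c
  have hk : (0 : ℝ) ≤ k := k.cast_nonneg
  rw [roomIndex, Nat.floor_eq_iff (by linarith)]
  constructor <;> linarith

section guards

variable {N k : ℕ} {G : Finset Plane}

lemma exists_guard {c : ℝ} {p : ℕ → Plane} (h : IsRoomChain c p N) (hG : G ⊆ roomPoints N)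
    (hg : IsGuardSet G (chainPolygon p N).region) {d : RoomCorner} (hd : d = A ∨ d = T)
    (hk : 5 * k + 2 ≤ N) (hw : roomPoint (N / 5) k d ∈ roomPoints N) :
    ∃ e, roomPoint (N / 5) k e ∈ G.filter (roomIndex · = k) ∧
      Sees (chainPolygon p N).region (roomPoint (N / 5) k e) (roomPoint (N / 5) k d) := by
  obtain ⟨g, hgG, hs⟩ := hg.exists_sees (h.mem_region hw)
  obtain ⟨k', e, hk', rfl⟩ := exists_room (hG hgG)
  have : k' = k := by
    by_contra hne
    exact h.not_sees_of_room_ne hk' hk hne hd hs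
  subst this
  exact ⟨e, Finset.mem_filter.2 ⟨hgG, roomIndex_roomPoint _ _ _⟩, hs⟩

lemma one_le_card_guards (hN : 3 ≤ N) (hG : G ⊆ roomPoints N)
    (hg : IsGuardSet G (chainPolygon (rightChain N) N).region) (hk : 5 * k + 2 ≤ N) :
    1 ≤ (G.filter (roomIndex · = k)).card := by
  obtain ⟨e, he, -⟩ := exists_guard (isRoomChain_rightChain hN) hG hg (Or.inr rfl) hk (T_mem hk)
  exact Finset.card_pos.2 ⟨_, he⟩

lemma two_le_card_guards (hN : 3 ≤ N) (hG : G ⊆ roomPoints N)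
    (hg : IsGuardSet G (chainPolygon (rightChain N) N).region)
    (hg' : IsGuardSet G (chainPolygon (leftChain N) N).region) (hk : 5 * k + 4 ≤ N) :
    2 ≤ (G.filter (roomIndex · = k)).card := by
  obtain ⟨e₁, h₁, s₁⟩ := exists_guard (isRoomChain_rightChain hN) hG hg (Or.inr rfl)
    (by omega) (T_mem (k := k) (by omega))
  obtain ⟨e₂, h₂, s₂⟩ := exists_guard (isRoomChain_rightChain hN) hG hg (Or.inl rfl)
    (by omega) (A_mem hk)
  obtain ⟨e₃, h₃, s₃⟩ := exists_guard (isRoomChain_leftChain hN) hG hg' (Or.inr rfl)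
    (by omega) (T_mem (k := k) (by omega))
  -- With fewer than two guards in the room, the three guards found above coincide, and each of the
  -- five corners fails one of the three sightings.
  by_contra! hlt
  have hle := Finset.card_le_one.1 (Nat.lt_succ_iff.1 hlt)
  rw [hle _ h₂ _ h₁] at s₂
  rw [hle _ h₃ _ h₁] at s₃
  cases e₁
  · exact right_L_not_sees_T hN (by omega) s₁
  · exact right_A_not_sees_T hN (by omega) s₁
  · exact left_T_not_sees_B hN hk s₃.symm
  · exact right_A_not_sees_T hN (by omega) s₂.symm
  · exact left_T_not_sees_R hN (by omega) s₃.symm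

theorem three_mul_div_eight_le_card (hN : 3 ≤ N) (hG : G ⊆ roomPoints N)
    (hg : IsGuardSet G (chainPolygon (rightChain N) N).region)
    (hg' : IsGuardSet G (chainPolygon (leftChain N) N).region) :
    3 * (N + 1) / 8 ≤ G.card := by
  have hmap : ∀ x ∈ G, roomIndex x ∈ Finset.range ((N + 1) / 5 + 1) := by
    intro x hx
    obtain ⟨k, c, hk, rfl⟩ := exists_room (hG hx)
    rw [roomIndex_roomPoint, Finset.mem_range]
    omega
  -- Rooms below `(N + 1) / 5` are full; the split-off term is the partial room, empty when 5
  -- divides `N + 1`.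
  rw [Finset.card_eq_sum_card_fiberwise hmap, Finset.sum_range_succ]
  have hfull : 2 * ((N + 1) / 5) ≤
      ∑ k ∈ Finset.range ((N + 1) / 5), (G.filter (roomIndex · = k)).card := by
    have := Finset.card_nsmul_le_sum (Finset.range ((N + 1) / 5))
      (fun k => (G.filter (roomIndex · = k)).card) 2 fun k hk =>
        two_le_card_guards hN hG hg hg' (by rw [Finset.mem_range] at hk; omega)
    rwa [Finset.card_range, smul_eq_mul, mul_comm] at this
  by_cases hr : 5 * ((N + 1) / 5) + 2 ≤ N
  · have := one_le_card_guards hN hG hg hr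
    omega
  · omega

end guards

theorem mainTheorem9 (n : ℕ) (hn : 4 ≤ n) :
    ((3 * n / 8 : ℕ) : ℕ∞) ≤ kUniversalGuardNumber n 2 := by
  obtain ⟨N, rfl⟩ : ∃ N, n = N + 1 := ⟨n - 1, by omega⟩
  have hN : 3 ≤ N := by omega
  refine le_iSup₂_of_le (roomPoints N) (card_roomPoints hN) ?_
  refine le_iSup₂_of_le
    {(chainPolygon (rightChain N) N).region, (chainPolygon (leftChain N) N).region}
    ⟨?_, Set.encard_pair (region_right_ne_left hN)⟩ ?_
  · rintro P (rfl | rfl)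
    · exact (isRoomChain_rightChain hN).mem_simplePolygons
    · exact (isRoomChain_leftChain hN).mem_simplePolygons
  · refine le_iInf₂ fun G hG => ?_
    exact_mod_cast three_mul_div_eight_le_card hN hG.1 (hG.2 _ (Set.mem_insert _ _))
      (hG.2 _ (Set.mem_insert_of_mem _ rfl))
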